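/- **Setting.** A program of A-Normal Featherweight Java consists of a class table (single inheritance, acyclic, with root `Object`), constructors `C(..){super(..); this.f = x; ...}`, methods whose bodies are sequences of uniquely labelled statements `v = e;` and `return v;`, where $e$ is one of $v$, $v.f$, $v.m(\vec v)$, `new` $C(\vec v)$, $(C)\,v$, and a designated method `main`. Labelled statements are identified with their labels. No typing is assumed. $\mathsf{Var}$ (variable and field names, including `this`), $\mathsf{Class}$, $\mathsf{Method}$ and $\mathsf{Stmt}=\mathsf{Lab}$ denote the finite sets of the program. The size of the program is the number of its classes, methods and statements plus the number of occurrences of variable and field names in them (the keyword `this` is counted only where it is written as a variable in a statement). For $k\ge 0$ let $\mathsf{Time}$ be the set of sequences of at most $k$ labels, $\mathsf{Addr}=(\mathsf{Var}+\mathsf{Method})\times\mathsf{Time}$, $\mathsf{KontPtr}=\mathsf{Method}\times\mathsf{Time}$, $\mathsf{BEnv}=\mathsf{Var}\rightharpoonup\mathsf{Addr}$, $\mathsf{Obj}=\mathsf{Class}\times\mathsf{BEnv}$, $\mathsf{Kont}=\mathsf{Var}\times\mathsf{Stmt}\times\mathsf{BEnv}\times\mathsf{KontPtr}$, $\mathsf{Store}=\mathsf{Addr}\to\mathcal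 P(\mathsf{Obj}+\mathsf{Kont})$. A state is a tuple $(s,\beta,\sigma,q,t)\in\mathsf{Stmt}\times\mathsf{BEnv}\times\mathsf{Store}\times\mathsf{KontPtr}\times\mathsf{Time}$. Every transition from the statement with label $\ell$ advances the time to $t'=\mathrm{first}_k(\ell:t)$ and only joins new values to the store. Assignment, cast, field reference and return do what their names say, looking up variables through $\beta$ and $\sigma$ and branching over all objects, respectively continuations, found there. `v = new C(..)` allocates every field $f$ of $C$ (declared or inherited) at $(f,t')$, runs the constructor, and creates the object $(C,[f\mapsto(f,t')])$. A call $v=v_0.m(\vec v)$ branches over the methods $M$ to which $m$ resolves for the objects in $\sigma(\beta(v_0))$, stores the continuation $(v,\mathrm{succ}(\ell),\beta,q)$ at $(M,t')$, binds parameters and local variables $x$ of $M$ at $(x,t')$ and binds `this` to the address $\beta(v_0)$ of the receiver variable. The initial state is at the first statement of `main`, with empty store and time, and with the variables of `main` and `this` allocated at the empty time. This is Shivers's $k$-CFA for Featherweight Java; call it the *sharing* analysis. The *copying* analysis differs in one point: a call treats `this` as one more parameter, with the address $(\mathtt{this},t')$ at which the value $\sigma(\beta(v_0))$ is joined. The single-threaded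 system space is $\Xi=\mathcal P(\mathsf{Stmt}\times\mathsf{BEnv}\times\mathsf{KontPtr}\times\mathsf{Time})\times\mathsf{Store}$, ordered by inclusion, with the transfer function $F$ that adds to $(\hat C,\sigma)$ the initial configuration, the configurations of all successors of $(c,\sigma)$, $c\in\hat C$, and the stores of these successors. **Claim.** Let $k\ge 0$. For every program and for each of the two analyses: 1. In every reachable state, all addresses in the range of the environment of an object carry the same time. In the environment of a frame (the current one or one saved in a continuation), all addresses of variables other than `this` carry the same time; in the copying analysis this includes `this`. 2. Environments can be replaced by times with no loss of precision. Let the *collapsed* analysis represent an object by $(C,u)\in\mathsf{Class}\times\mathsf{Time}$, standing for $(C,[f\mapsto(f,u)])$, and a frame of $M$ by its time $u$, in the sharing analysis together with the address in $\mathsf{Var}\times\mathsf{Time}$ of `this`, standing for $[x\mapsto(x,u)]$ on the declared variables $x$ of $M$ and the given binding of `this`. The method $M$ is the one in the continuation pointer. For each class with at least one field the map from times to object environments is injective; for each method with at least one declared variable, and in the copying analysis for every method, the map from collapsed frames to environments is injective. Decoding maps the collapsed initial state to the initial state; the successors of the decoding of any collapsed state are exactly the decodings of its successors; the reachable states are exactly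 the decodings of the reachable collapsed states; and decoding commutes with the transfer functions of the single-threaded system spaces, so that $F^n(\bot)$ is the decoding of the $n$-th collapsed iterate for every $n$. 3. Let $w=1$ for the copying analysis and $w=|\mathsf{Var}|\cdot|\mathsf{Time}|$ for the sharing analysis. The collapsed system space has height exactly $$H=w\,|\mathsf{Stmt}|\,|\mathsf{Time}|^3\,|\mathsf{Method}|+|\mathsf{Method}+\mathsf{Var}|\,|\mathsf{Time}|\,\bigl(|\mathsf{Class}|\,|\mathsf{Time}|+w\,|\mathsf{Var}|\,|\mathsf{Stmt}|\,|\mathsf{Time}|\,|\mathsf{Method}|\,|\mathsf{Time}|\bigr),$$ and the part of $\Xi$ that consists of decodings of its elements (to which all iterates $F^n(\bot)$ belong) has height at most $H$. For some $N\le H$, $F^N(\bot)$ is the least fixed point of $F$. 4. For fixed $k$, $H$ is polynomial: there is a polynomial $p_k$ with $H\le p_k(\text{size of the program})$ for all programs and both analyses. -/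

import Mathlib

/-! # A-Normal Featherweight Java and its `k`-CFA -/

namespace FJ

/-! ## Syntax -/

/-- Expressions of A-Normal Featherweight Java: `v`, `v.f`, `v.m(vs)`, `new C(vs)`, `(C) v`. -/
inductive Exp (Var Cls MName : Type) : Type
  | var (v : Var)
  | field (v f : Var)
  | call (v : Var) (m : MName) (args : List Var)
  | newObj (C : Cls) (args : List Var)
  | cast (C : Cls) (v : Var)

/-- Statements `v = e;` and `return v;`. The label is carried by the program table. -/
inductive Stmt (Var Cls MName : Type) : Type
  | assign (v : Var) (e : Exp Var Cls MName)
  | ret (v : Var)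

/-- A constructor `C (C f, ...) { super(f', ...); this.f'' = f'''; ... }`. A pair `(f, x)` in
`inits` is the assignment `this.f = x`. -/
structure Konst (Var Cls : Type) : Type where
  params : List (Cls × Var)
  superArgs : List Var
  inits : List (Var × Var)

/-- A class declaration without its methods (these point to their class). The parent is `none`
for the class `Object` only. -/
structure ClassDecl (Var Cls : Type) : Type where
  parent : Option Cls
  fields : List (Cls × Var)
  konst : Konst Var Cls

/-- A method declaration `C m (C v, ...) { C v; ... s ... }` in the class `owner`. The body lists
the labels of its statements. -/
structure MethodDecl (Var Cls MName Lab : Type) : Type where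
  owner : Cls
  retType : Cls
  name : MName
  params : List (Cls × Var)
  locals : List (Cls × Var)
  body : List Lab

section Names
variable {Var Cls MName Lab : Type}

/-- Variable and field names in an expression, with repetitions. -/
def Exp.names : Exp Var Cls MName → List Var
  | .var v => [v]
  | .field v f => [v, f]
  | .call v _ args => v :: args
  | .newObj _ args => args
  | .cast _ v => [v]

def Stmt.names : Stmt Var Cls MName → List Var
  | .assign v e => v :: e.names
  | .ret v => [v]

def ClassDecl.names (D : ClassDecl Var Cls) : List Var :=
  D.fields.map Prod.snd ++ D.konst.params.map Prod.snd ++ D.konst.superArgs ++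
    D.konst.inits.flatMap (fun p => [p.1, p.2])

/-- The declared parameters and local variables of a method. -/
def MethodDecl.names (D : MethodDecl Var Cls MName Lab) : List Var :=
  D.params.map Prod.snd ++ D.locals.map Prod.snd

end Names

/-- A program: `Var` holds its variable and field names, `Cls` its classes, `Mth` its method
declarations and `Lab` its statement labels. Every statement of the program has its own label, so
that a labelled statement is identified with its label. Execution starts in the body of `main`. No
typing discipline is imposed. -/
structure Program : Type 1 where
  Var : Type
  Cls : Type
  MName : Type
  Mth : Type
  Lab : Type
  [fintypeVar : Fintype Var]
  [fintypeCls : Fintype Cls]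
  [fintypeMth : Fintype Mth]
  [fintypeLab : Fintype Lab]
  /-- the keyword `this` -/
  self : Var
  object : Cls
  classDecl : Cls → ClassDecl Var Cls
  methodDecl : Mth → MethodDecl Var Cls MName Lab
  stmt : Lab → Stmt Var Cls MName
  main : Mth
  object_decl : classDecl object = ⟨none, [], ⟨[], [], []⟩⟩
  parent_ne_none : ∀ C, C ≠ object → (classDecl C).parent ≠ none
  owner_ne_object : ∀ M, (methodDecl M).owner ≠ object
  /-- there is no cycle in the class hierarchy -/
  parent_wf : WellFounded (fun D C => (classDecl C).parent = some D)
  /-- a class declares at most one method of each name -/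
  no_overload : ∀ M N, (methodDecl M).owner = (methodDecl N).owner →
    (methodDecl M).name = (methodDecl N).name → M = N
  /-- `this` is a keyword and cannot be declared as a parameter or a local variable -/
  self_not_declared : ∀ M, self ∉ (methodDecl M).names
  body_ne_nil : ∀ M, (methodDecl M).body ≠ []
  body_nodup : ∀ M, (methodDecl M).body.Nodup
  label_unique : ∀ l, ∃! M, l ∈ (methodDecl M).body
  /-- `Var` has no element beside the names of the program -/
  var_occurs : ∀ x, x = self ∨ (∃ C, x ∈ (classDecl C).names) ∨
    (∃ M, x ∈ (methodDecl M).names) ∨ ∃ l, x ∈ (stmt l).names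

attribute [instance] Program.fintypeVar Program.fintypeCls Program.fintypeMth Program.fintypeLab

namespace Program
variable (P : Program)

/-- The size of the program text: all class, method and statement occurrences, and all
occurrences of variable and field names in them. -/
def size : ℕ :=
  (∑ C, (1 + (P.classDecl C).names.length)) + (∑ M, (1 + (P.methodDecl M).names.length)) +
    ∑ l, (1 + (P.stmt l).names.length)

/-- The first statement of a method. -/
def entry (M : P.Mth) : P.Lab := (P.methodDecl M).body.head (P.body_ne_nil M)

/-- `succ(l) = l'`: the statement `l'` follows the statement `l` in its body. -/
def Succ (l l' : P.Lab) : Prop :=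
  ∃ M pre post, (P.methodDecl M).body = pre ++ l :: l' :: post

def methodParams (M : P.Mth) : List P.Var := (P.methodDecl M).params.map Prod.snd

def ctorParams (C : P.Cls) : List P.Var := (P.classDecl C).konst.params.map Prod.snd

/-- `f` is a field of the class `C`, declared in `C` or inherited. -/
inductive IsField : P.Cls → P.Var → Prop
  | own {C f} (h : f ∈ (P.classDecl C).fields.map Prod.snd) : IsField C f
  | inherited {C D f} (h : (P.classDecl C).parent = some D) (hf : IsField D f) : IsField C f

/-- Running the constructor of `C` stores the value of its `i`-th argument in the field `f`,
either by an assignment of its own or in the constructor of the parent class. -/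
inductive ArgFlows : P.Cls → ℕ → P.Var → Prop
  | own {C i f x} (hx : (P.ctorParams C)[i]? = some x)
      (hf : (f, x) ∈ (P.classDecl C).konst.inits) : ArgFlows C i f
  | super {C D i j f x} (hD : (P.classDecl C).parent = some D)
      (hx : (P.ctorParams C)[i]? = some x)
      (hj : (P.classDecl C).konst.superArgs[j]? = some x)
      (hf : ArgFlows D j f) : ArgFlows C i f

/-- `M` is the method that a call of `m` on an object of class `C` runs: the declaration in the
nearest class on the way from `C` to `Object`. -/
inductive Lookup : P.Cls → P.MName → P.Mth → Prop
  | here {C m M} (ho : (P.methodDecl M).owner = C) (hm : (P.methodDecl M).name = m) :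
      Lookup C m M
  | up {C D m M} (hC : ∀ N, (P.methodDecl N).owner = C → (P.methodDecl N).name ≠ m)
      (hD : (P.classDecl C).parent = some D) (h : Lookup D m M) : Lookup C m M

end Program

/-! ## The abstract state space of `k`-CFA -/

section Space
variable (P : Program) (k : ℕ)

/-- Abstract times: the most recent labels, at most `k` of them. -/
abbrev Time : Type := {w : List P.Lab // w.length ≤ k}

/-- Abstract addresses: a variable, a field or a method, with a time. -/
abbrev Addr : Type := (P.Var ⊕ P.Mth) × Time P k

/-- Addresses of continuations: a method with a time. -/
abbrev KontPtr : Type := P.Mth × Time P k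

abbrev BEnv : Type := P.Var → Option (Addr P k)
abbrev Obj : Type := P.Cls × BEnv P k
abbrev Kont : Type := P.Var × P.Lab × BEnv P k × KontPtr P k
abbrev Val : Type := Obj P k ⊕ Kont P k
abbrev Store : Type := Addr P k → Set (Val P k)

/-- A state without its store: statement, environment, continuation pointer, time. -/
abbrev Config : Type := P.Lab × BEnv P k × KontPtr P k × Time P k
abbrev State : Type := Config P k × Store P k

/-- The system space with a single-threaded store, ordered componentwise by inclusion. -/
abbrev Sys : Type := Set (Config P k) × Store P k

end Space

variable {P : Program} {k : ℕ}

/-- The initial time, in which no label has been passed. -/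
def time₀ : Time P k := ⟨[], Nat.zero_le k⟩

/-- The first `k` labels of `l : t`. -/
def tick (l : P.Lab) (t : Time P k) : Time P k :=
  ⟨(l :: t.1).take k, by simp⟩

def alloc (x : P.Var) (t : Time P k) : Addr P k := (Sum.inl x, t)

def kontAddr (q : KontPtr P k) : Addr P k := (Sum.inr q.1, q.2)

/-- The store `[a ↦ d]`. -/
def single {V : Type} (a : Addr P k) (d : Set V) : Addr P k → Set V :=
  fun b => {x | b = a ∧ x ∈ d}

/-- The store `[alloc(xᵢ, t) ↦ dᵢ]`. -/
def bindAll {V : Type} (xs : List P.Var) (t : Time P k) (ds : List (Set V)) :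
    Addr P k → Set V :=
  fun b => {y | ∃ p ∈ xs.zip ds, b = alloc p.1 t ∧ y ∈ p.2}

/-- The store that the constructor of `C` contributes when its arguments are `ds` and the fields
are allocated at time `t`. -/
def fieldStore {V : Type} (C : P.Cls) (t : Time P k) (ds : List (Set V)) : Addr P k → Set V :=
  fun b => {y | ∃ f i d, P.IsField C f ∧ P.ArgFlows C i f ∧ ds[i]? = some d ∧
    b = alloc f t ∧ y ∈ d}

open Classical in
/-- The record of an object of class `C` whose fields are allocated at time `t`. -/
noncomputable def record (C : P.Cls) (t : Time P k) : BEnv P k :=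
  fun f => if P.IsField C f then some (alloc f t) else none

open Classical in
/-- The environment of a frame of `M` whose parameters and local variables are allocated at time
`t` and in which `this` is bound to the address `a`. -/
noncomputable def frameEnv (M : P.Mth) (a : Addr P k) (t : Time P k) : BEnv P k :=
  fun x => if x ∈ (P.methodDecl M).names then some (alloc x t)
    else if x = P.self then some a else none

/-- The methods that a call of `m` on the abstract value `d` may run. -/
def dispatch (d : Set (Val P k)) (m : P.MName) : Set P.Mth :=
  {M | ∃ C β, Sum.inl (C, β) ∈ d ∧ P.Lookup C m M}

/-- How a method invocation binds `this`: `share` reuses the address of the receiver variable,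
`[this ↦ β(v₀)]`; `copy` treats `this` as one more parameter, with an address of its own allocated
at the new time. -/
inductive ThisRule : Type
  | share
  | copy

/-- The address of `this` in a new frame; `a` is the address of the receiver variable. -/
def thisAddr : ThisRule → Addr P k → Time P k → Addr P k
  | .share, a, _ => a
  | .copy, _, t => alloc P.self t

/-- The store update for `this`; `d` is the value of the receiver. -/
def thisStore {V : Type} : ThisRule → Set V → Time P k → (Addr P k → Set V)
  | .share, _, _ => ⊥
  | .copy, d, t => single (alloc P.self t) d

/-- The transition relation of `k`-CFA. A rule does not apply when a variable that it looks up is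
unbound or the number of arguments is wrong. -/
inductive Step (r : ThisRule) : State P k → State P k → Prop
  | var {l l' v v' β σ q t a a'}
      (hs : P.stmt l = .assign v (.var v')) (hl : P.Succ l l')
      (hv : β v = some a) (hv' : β v' = some a') :
      Step r ((l, β, q, t), σ) ((l', β, q, tick l t), σ ⊔ single a (σ a'))
  | ret {l v v' s β β' σ q q' t a a'}
      (hs : P.stmt l = .ret v) (hk : Sum.inr (v', s, β', q') ∈ σ (kontAddr q))
      (hv : β v = some a) (hv' : β' v' = some a') :
      Step r ((l, β, q, t), σ) ((s, β', q', tick l t), σ ⊔ single a' (σ a))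
  | field {l l' v v' f C β β' σ q t a a' b}
      (hs : P.stmt l = .assign v (.field v' f)) (hl : P.Succ l l')
      (hv : β v = some a) (hv' : β v' = some a')
      (ho : Sum.inl (C, β') ∈ σ a') (hf : β' f = some b) :
      Step r ((l, β, q, t), σ) ((l', β, q, tick l t), σ ⊔ single a (σ b))
  | call {l l' v v₀ m args β σ q t a₀ as M}
      (hs : P.stmt l = .assign v (.call v₀ m args)) (hl : P.Succ l l')
      (hv₀ : β v₀ = some a₀) (hargs : List.Forall₂ (fun x a => β x = some a) args as)
      (hM : M ∈ dispatch (σ a₀) m) (hn : args.length = (P.methodParams M).length) :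
      Step r ((l, β, q, t), σ)
        ((P.entry M, frameEnv M (thisAddr r a₀ (tick l t)) (tick l t), (M, tick l t), tick l t),
          σ ⊔ single (kontAddr (M, tick l t)) {Sum.inr (v, l', β, q)}
            ⊔ bindAll (P.methodParams M) (tick l t) (as.map σ)
            ⊔ thisStore r (σ a₀) (tick l t))
  | newObj {l l' v C args β σ q t a as}
      (hs : P.stmt l = .assign v (.newObj C args)) (hl : P.Succ l l')
      (hv : β v = some a) (hargs : List.Forall₂ (fun x a => β x = some a) args as)
      (hn : args.length = (P.ctorParams C).length) :
      Step r ((l, β, q, t), σ)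
        ((l', β, q, tick l t),
          σ ⊔ fieldStore C (tick l t) (as.map σ)
            ⊔ single a {Sum.inl (C, record C (tick l t))})
  | cast {l l' v v' C β σ q t a a'}
      (hs : P.stmt l = .assign v (.cast C v')) (hl : P.Succ l l')
      (hv : β v = some a) (hv' : β v' = some a') :
      Step r ((l, β, q, t), σ) ((l', β, q, tick l t), σ ⊔ single a (σ a'))

/-- The initial configuration: the first statement of `main`, with the variables of `main`
allocated at the initial time. -/
noncomputable def config₀ : Config P k :=
  (P.entry P.main, frameEnv P.main (alloc P.self time₀) time₀, (P.main, time₀), time₀)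

/-- The initial state has the empty store. -/
noncomputable def state₀ : State P k := (config₀, ⊥)

def Reachable (r : ThisRule) (s : State P k) : Prop := Relation.ReflTransGen (Step r) state₀ s

/-- The transfer function of `k`-CFA with a single-threaded store. -/
noncomputable def transfer (r : ThisRule) (ξ : Sys P k) : Sys P k :=
  ({config₀} ∪ ξ.1 ∪ {c' | ∃ c ∈ ξ.1, ∃ σ', Step r (c, ξ.2) (c', σ')},
    fun a => ξ.2 a ∪ {x | ∃ c ∈ ξ.1, ∃ c' σ', Step r (c, ξ.2) (c', σ') ∧ x ∈ σ' a})

/-- All addresses in the range of the environment carry the same time. -/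
def OneTime (β : BEnv P k) : Prop :=
  ∀ x y a b, β x = some a → β y = some b → a.2 = b.2

/-- All addresses to which the environment maps variables other than `this` carry the same
time. -/
def OneTimeButThis (β : BEnv P k) : Prop :=
  ∀ x y a b, x ≠ P.self → y ≠ P.self → β x = some a → β y = some b → a.2 = b.2

/-- `β` is the record of an object in the state. -/
def IsRecordIn (β : BEnv P k) (s : State P k) : Prop :=
  ∃ a C, Sum.inl (C, β) ∈ s.2 a

/-- `β` is the environment of the current frame of the state, or of a frame that is saved in a
continuation in its store. -/
def IsFrameIn (β : BEnv P k) (s : State P k) : Prop :=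
  β = s.1.2.1 ∨ ∃ a v l q, Sum.inr (v, l, β, q) ∈ s.2 a

/-! ## The collapsed analysis: times instead of environments -/

section Collapsed
variable (P k)

/-- What a collapsed frame records about `this`: under `share` the address of `this`, under
`copy` nothing. -/
def ThisRef : ThisRule → Type
  | .share => P.Var × Time P k
  | .copy => Unit

/-- A frame is replaced by its time of allocation (and the address of `this`, under `share`). -/
abbrev CFrame (r : ThisRule) : Type := Time P k × ThisRef P k r

/-- An object is replaced by its class and its time of allocation. -/
abbrev CObj : Type := P.Cls × Time P k
abbrev CKont (r : ThisRule) : Type := P.Var × P.Lab × CFrame P k r × KontPtr P k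
abbrev CVal (r : ThisRule) : Type := CObj P k ⊕ CKont P k r
abbrev CStore (r : ThisRule) : Type := Addr P k → Set (CVal P k r)
abbrev CConfig (r : ThisRule) : Type := P.Lab × CFrame P k r × KontPtr P k × Time P k
abbrev CState (r : ThisRule) : Type := CConfig P k r × CStore P k r
abbrev CSys (r : ThisRule) : Type := Set (CConfig P k r) × CStore P k r

end Collapsed

/-- The variable and the time that make up the address of `this` in a collapsed frame. -/
def thisOf : (r : ThisRule) → CFrame P k r → P.Var × Time P k
  | .share, φ => φ.2
  | .copy, φ => (P.self, φ.1)

/-- The collapsed frame that is entered at time `t`; `p` is the address of the receiver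
variable. -/
def newFrame : (r : ThisRule) → P.Var × Time P k → Time P k → CFrame P k r
  | .share, p, t => (t, p)
  | .copy, _, t => (t, ())

open Classical in
/-- The address of a variable in a collapsed frame of the method `M`. -/
noncomputable def look {r : ThisRule} (M : P.Mth) (φ : CFrame P k r) (x : P.Var) :
    Option (P.Var × Time P k) :=
  if x ∈ (P.methodDecl M).names then some (x, φ.1)
  else if x = P.self then some (thisOf r φ) else none

def cDispatch {r : ThisRule} (d : Set (CVal P k r)) (m : P.MName) : Set P.Mth :=
  {M | ∃ C u, Sum.inl (C, u) ∈ d ∧ P.Lookup C m M}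

/-- The transition relation of the collapsed analysis. The method of the current frame is read
off the continuation pointer. -/
inductive CStep (r : ThisRule) : CState P k r → CState P k r → Prop
  | var {l l' v v' φ σ q t p p'}
      (hs : P.stmt l = .assign v (.var v')) (hl : P.Succ l l')
      (hv : look q.1 φ v = some p) (hv' : look q.1 φ v' = some p') :
      CStep r ((l, φ, q, t), σ)
        ((l', φ, q, tick l t), σ ⊔ single (alloc p.1 p.2) (σ (alloc p'.1 p'.2)))
  | ret {l v v' s φ φ' σ q q' t p p'}
      (hs : P.stmt l = .ret v) (hk : Sum.inr (v', s, φ', q') ∈ σ (kontAddr q))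
      (hv : look q.1 φ v = some p) (hv' : look q'.1 φ' v' = some p') :
      CStep r ((l, φ, q, t), σ)
        ((s, φ', q', tick l t), σ ⊔ single (alloc p'.1 p'.2) (σ (alloc p.1 p.2)))
  | field {l l' v v' f C u φ σ q t p p'}
      (hs : P.stmt l = .assign v (.field v' f)) (hl : P.Succ l l')
      (hv : look q.1 φ v = some p) (hv' : look q.1 φ v' = some p')
      (ho : Sum.inl (C, u) ∈ σ (alloc p'.1 p'.2)) (hf : P.IsField C f) :
      CStep r ((l, φ, q, t), σ)
        ((l', φ, q, tick l t), σ ⊔ single (alloc p.1 p.2) (σ (alloc f u)))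
  | call {l l' v v₀ m args φ σ q t p₀ ps M}
      (hs : P.stmt l = .assign v (.call v₀ m args)) (hl : P.Succ l l')
      (hv₀ : look q.1 φ v₀ = some p₀)
      (hargs : List.Forall₂ (fun x p => look q.1 φ x = some p) args ps)
      (hM : M ∈ cDispatch (σ (alloc p₀.1 p₀.2)) m)
      (hn : args.length = (P.methodParams M).length) :
      CStep r ((l, φ, q, t), σ)
        ((P.entry M, newFrame r p₀ (tick l t), (M, tick l t), tick l t),
          σ ⊔ single (kontAddr (M, tick l t)) {Sum.inr (v, l', φ, q)}
            ⊔ bindAll (P.methodParams M) (tick l t) (ps.map (fun p => σ (alloc p.1 p.2)))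
            ⊔ thisStore r (σ (alloc p₀.1 p₀.2)) (tick l t))
  | newObj {l l' v C args φ σ q t p ps}
      (hs : P.stmt l = .assign v (.newObj C args)) (hl : P.Succ l l')
      (hv : look q.1 φ v = some p)
      (hargs : List.Forall₂ (fun x p => look q.1 φ x = some p) args ps)
      (hn : args.length = (P.ctorParams C).length) :
      CStep r ((l, φ, q, t), σ)
        ((l', φ, q, tick l t),
          σ ⊔ fieldStore C (tick l t) (ps.map (fun p => σ (alloc p.1 p.2)))
            ⊔ single (alloc p.1 p.2) {Sum.inl (C, tick l t)})
  | cast {l l' v v' C φ σ q t p p'}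
      (hs : P.stmt l = .assign v (.cast C v')) (hl : P.Succ l l')
      (hv : look q.1 φ v = some p) (hv' : look q.1 φ v' = some p') :
      CStep r ((l, φ, q, t), σ)
        ((l', φ, q, tick l t), σ ⊔ single (alloc p.1 p.2) (σ (alloc p'.1 p'.2)))

def cConfig₀ (r : ThisRule) : CConfig P k r :=
  (P.entry P.main, newFrame r (P.self, time₀) time₀, (P.main, time₀), time₀)

def cState₀ (r : ThisRule) : CState P k r := (cConfig₀ r, ⊥)

def CReachable (r : ThisRule) (s : CState P k r) : Prop :=
  Relation.ReflTransGen (CStep r) (cState₀ r) s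

def cTransfer (r : ThisRule) (ξ : CSys P k r) : CSys P k r :=
  ({cConfig₀ r} ∪ ξ.1 ∪ {c' | ∃ c ∈ ξ.1, ∃ σ', CStep r (c, ξ.2) (c', σ')},
    fun a => ξ.2 a ∪ {x | ∃ c ∈ ξ.1, ∃ c' σ', CStep r (c, ξ.2) (c', σ') ∧ x ∈ σ' a})

/-! ## From times back to environments -/

/-- The environment that a collapsed frame of the method `M` stands for. -/
noncomputable def decodeFrame {r : ThisRule} (M : P.Mth) (φ : CFrame P k r) : BEnv P k :=
  frameEnv M (alloc (thisOf r φ).1 (thisOf r φ).2) φ.1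

noncomputable def decodeVal {r : ThisRule} : CVal P k r → Val P k
  | Sum.inl (C, t) => Sum.inl (C, record C t)
  | Sum.inr (v, l, φ, q) => Sum.inr (v, l, decodeFrame q.1 φ, q)

noncomputable def decodeConfig {r : ThisRule} : CConfig P k r → Config P k
  | (l, φ, q, t) => (l, decodeFrame q.1 φ, q, t)

noncomputable def decodeStore {r : ThisRule} (σ : CStore P k r) : Store P k :=
  fun a => decodeVal '' σ a

noncomputable def decodeState {r : ThisRule} (s : CState P k r) : State P k :=
  (decodeConfig s.1, decodeStore s.2)

noncomputable def decodeSys {r : ThisRule} (ξ : CSys P k r) : Sys P k :=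
  (decodeConfig '' ξ.1, decodeStore ξ.2)

/-! ## The height of the collapsed system space -/

/-- The factor that the address of `this` contributes to the number of frames. -/
noncomputable def thisFactor (P : Program) (k : ℕ) : ThisRule → ℕ
  | .share => Nat.card P.Var * Nat.card (Time P k)
  | .copy => 1

/-- `w·|Stmt|·|Time|³·|Method| + |Method + Var|·|Time|·(|Class|·|Time| +
w·|Var|·|Stmt|·|Time|·|Method|·|Time|)`, where `w` is the factor for `this` and `Stmt` is
identified with `Lab`. -/
noncomputable def heightBound (P : Program) (k : ℕ) (r : ThisRule) : ℕ :=
  thisFactor P k r * (Nat.card P.Lab * Nat.card (Time P k) ^ 3 * Nat.card P.Mth) +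
    Nat.card (P.Mth ⊕ P.Var) * Nat.card (Time P k) *
      (Nat.card P.Cls * Nat.card (Time P k) +
        thisFactor P k r * (Nat.card P.Var * Nat.card P.Lab * Nat.card (Time P k) *
          Nat.card P.Mth * Nat.card (Time P k)))

end FJ

/-! Featherweight Java has no closures over nested scopes. Every environment is created in one go,
by `new` or by a call, and all its addresses get the time of that event; the only exception is
`this` in the sharing analysis, where an old address is reused. The class or method gives the domain
of the environment, so the time (with the address of `this`, if shared) describes it completely. The
method of a frame need not be stored: a call installs frame and continuation pointer for the same
method, and a continuation saves both together.

Instead of proving this as an invariant along runs, the proof shows that decoding is a bisimulation.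
Transition rules consult environments only by looking up variables, and stores only by membership
and join. Lookup commutes with decoding, and decoding of stores is a pointwise direct image, which
preserves joins. Hence steps transfer in both directions (`CStep.decode`, `Step.exists_cStep`),
without any injectivity. So every reachable state is a decoding, which gives the claim on times, and
the transfer functions commute with decoding (`transfer_decodeSys`), which carries over to all
iterates.

A collapsed system is a subset of the finite set of configurations plus pairs of an address and a
value, so the height is the number of these elements. The collapsed iteration is increasing and
therefore stops within that many rounds; its decoding is then a fixed point of the original transfer
function, and the least one by monotonicity. The height is polynomial because, for fixed `k`, the
number of times is at most a `k`-th power, whereas the number of maps from variables to addresses is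
exponential in the number of variables. -/

/-! ## Finite orders -/

namespace Order

/-- The lattice of subsets of a finite type has the size of the type as its height. -/
theorem krullDim_set (α : Type*) [Finite α] : krullDim (Set α) = (Nat.card α : ℕ) := by
  apply le_antisymm
  · refine iSup_le fun l => ?_
    have h : StrictMono fun i => (l i).ncard := fun i j hij =>
      Set.ncard_lt_ncard (l.strictMono hij) (Set.toFinite _)
    -- Each strict inclusion adds at least one element, so the last set of the chain has at least as
    -- many elements as the chain has steps.
    have h₁ : ∀ i : Fin (l.length + 1), (i : ℕ) ≤ (l i).ncard := by
      intro i
      induction i using Fin.induction with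
      | zero => simp
      | succ i ih => exact Nat.succ_le_of_lt (ih.trans_lt (h i.castSucc_lt_succ))
    have h₂ := h₁ (Fin.last _)
    rw [Fin.val_last] at h₂
    exact_mod_cast h₂.trans (Set.ncard_le_card _)
  · have e := Finite.equivFin α
    -- The initial segments of an enumeration form a chain of maximal length; the `i`-th element is
    -- what step `i` adds.
    refine le_krullDim_iff.mpr ⟨LTSeries.mk (Nat.card α) (fun i => {x | (e x : ℕ) < i}) ?_, rfl⟩
    refine Fin.strictMono_iff_lt_succ.mpr fun i => ?_
    refine (Set.ssubset_iff_of_subset fun x hx => ?_).mpr ⟨e.symm i, ?_, ?_⟩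
    · exact Nat.lt_succ_of_lt hx
    · simp
    · simp

/-- A pair of a subset of `α` and a family of subsets of `β` is a subset of `α ⊕ ι × β`. -/
def _root_.OrderIso.setProdPiSet (α ι β : Type*) : Set α × (ι → Set β) ≃o Set (α ⊕ ι × β) where
  toFun p := Sum.inl '' p.1 ∪ Sum.inr '' {x | x.2 ∈ p.2 x.1}
  invFun s := (Sum.inl ⁻¹' s, fun i => {b | Sum.inr (i, b) ∈ s})
  left_inv p := by ext <;> simp
  right_inv s := by ext (x | x) <;> simp
  map_rel_iff' {p q} := by
    constructor
    · intro h
      refine ⟨fun a ha => ?_, fun i b hb => ?_⟩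
      · have := h (Or.inl ⟨a, ha, rfl⟩)
        simpa using this
      · have := h (Or.inr ⟨(i, b), hb, rfl⟩)
        simpa using this
    · rintro ⟨h₁, h₂⟩ x (⟨a, ha, rfl⟩ | ⟨⟨i, b⟩, hb, rfl⟩)
      · exact Or.inl ⟨a, h₁ ha, rfl⟩
      · exact Or.inr ⟨(i, b), h₂ i hb, rfl⟩

theorem krullDim_set_prod_pi_set (α ι β : Type*) [Finite α] [Finite ι] [Finite β] :
    krullDim (Set α × (ι → Set β)) = (Nat.card α + Nat.card ι * Nat.card β : ℕ) := by
  rw [krullDim_eq_of_orderIso (OrderIso.setProdPiSet α ι β), krullDim_set, Nat.card_sum,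
    Nat.card_prod]

/-- An inflationary function on an order of height `n` reaches a fixed point from any start within
`n` rounds. -/
theorem exists_iterate_isFixedPt {α : Type*} [PartialOrder α] {f : α → α} (hf : ∀ x, x ≤ f x)
    (x : α) {n : ℕ} (hn : krullDim α ≤ n) : ∃ N ≤ n, Function.IsFixedPt f (f^[N] x) := by
  by_contra! h
  have hlt : ∀ i : Fin (n + 1), f^[i] x < f^[i + 1] x := fun i => by
    rw [Function.iterate_succ_apply']
    exact lt_of_le_of_ne (hf _) fun e => h i (Nat.le_of_lt_succ i.2) e.symm
  -- If none of the iterates `0, …, n` is fixed, then the iterates up to `n + 1` form a chain that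
  -- is longer than the height.
  let l : LTSeries α := LTSeries.mk (n + 1) (fun i => f^[i] x)
    (Fin.strictMono_iff_lt_succ.mpr fun i => by simpa using hlt i)
  have := (LTSeries.length_le_krullDim l).trans hn
  have : n + 1 ≤ n := by exact_mod_cast this
  omega

/-- If an iterate of a monotone function from `⊥` is a fixed point, then it is the least one. -/
theorem isLeast_fixedPoints_iterate_bot {α : Type*} [PartialOrder α] [OrderBot α] {f : α → α}
    (hf : Monotone f) {N : ℕ} (hN : Function.IsFixedPt f (f^[N] ⊥)) :
    IsLeast (Function.fixedPoints f) (f^[N] ⊥) := by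
  refine ⟨hN, fun x hx => ?_⟩
  calc f^[N] ⊥ ≤ f^[N] x := hf.iterate N bot_le
    _ = x := Function.iterate_fixed hx N

end Order

namespace FJ

variable {P : Program} {k : ℕ} {r : ThisRule}

/-! ## Decoding -/

theorem decodeFrame_apply (M : P.Mth) (φ : CFrame P k r) (x : P.Var) :
    decodeFrame M φ x = (look M φ x).map fun p => alloc p.1 p.2 := by
  unfold decodeFrame frameEnv look
  split_ifs <;> rfl

theorem decodeFrame_eq_some {M : P.Mth} {φ : CFrame P k r} {x : P.Var} {a : Addr P k} :
    decodeFrame M φ x = some a ↔ ∃ p, look M φ x = some p ∧ alloc p.1 p.2 = a := by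
  rw [decodeFrame_apply, Option.map_eq_some_iff]

theorem forall₂_decodeFrame {M : P.Mth} {φ : CFrame P k r} {xs : List P.Var}
    {as : List (Addr P k)} :
    List.Forall₂ (fun x a => decodeFrame M φ x = some a) xs as ↔
      ∃ ps, List.Forall₂ (fun x p => look M φ x = some p) xs ps ∧
        ps.map (fun p => alloc p.1 p.2) = as := by
  constructor
  · intro h
    induction h with
    | nil => exact ⟨[], .nil, rfl⟩
    | cons h _ ih =>
      obtain ⟨p, hp, rfl⟩ := decodeFrame_eq_some.mp h
      obtain ⟨ps, hps, rfl⟩ := ih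
      exact ⟨p :: ps, .cons hp hps, rfl⟩
  · rintro ⟨ps, h, rfl⟩
    rw [List.forall₂_map_right_iff]
    exact h.imp fun x p hp => decodeFrame_eq_some.mpr ⟨p, hp, rfl⟩

/-- Decoding respects the two summands of a value and keeps the class, so an object can only come
from a collapsed object of the same class. Its time need not be unique: without fields, all times
give the same record. -/
theorem inl_mem_decodeStore {σ : CStore P k r} {a : Addr P k} {C : P.Cls} {β : BEnv P k} :
    Sum.inl (C, β) ∈ decodeStore σ a ↔ ∃ u, Sum.inl (C, u) ∈ σ a ∧ record C u = β := by
  constructor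
  · rintro ⟨⟨C', u⟩ | ⟨v, l, φ, q⟩, hx, h⟩
    · simp only [decodeVal, Sum.inl.injEq, Prod.mk.injEq] at h
      obtain ⟨rfl, rfl⟩ := h
      exact ⟨u, hx, rfl⟩
    · simp [decodeVal] at h
  · rintro ⟨u, hu, rfl⟩
    exact ⟨_, hu, rfl⟩

theorem inr_mem_decodeStore {σ : CStore P k r} {a : Addr P k} {v : P.Var} {l : P.Lab}
    {β : BEnv P k} {q : KontPtr P k} :
    Sum.inr (v, l, β, q) ∈ decodeStore σ a ↔
      ∃ φ, Sum.inr (v, l, φ, q) ∈ σ a ∧ decodeFrame q.1 φ = β := by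
  constructor
  · rintro ⟨⟨C', u⟩ | ⟨v', l', φ, q'⟩, hx, h⟩
    · simp [decodeVal] at h
    · simp only [decodeVal, Sum.inr.injEq, Prod.mk.injEq] at h
      obtain ⟨rfl, rfl, rfl, rfl⟩ := h
      exact ⟨φ, hx, rfl⟩
  · rintro ⟨φ, hφ, rfl⟩
    exact ⟨_, hφ, rfl⟩

theorem dispatch_decodeStore (σ : CStore P k r) (a : Addr P k) (m : P.MName) :
    dispatch (decodeStore σ a) m = cDispatch (σ a) m := by
  ext M
  constructor
  · rintro ⟨C, β, h, hM⟩
    obtain ⟨u, hu, -⟩ := inl_mem_decodeStore.mp h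
    exact ⟨C, u, hu, hM⟩
  · rintro ⟨C, u, h, hM⟩
    exact ⟨C, _, inl_mem_decodeStore.mpr ⟨u, h, rfl⟩, hM⟩

theorem record_eq_some {C : P.Cls} {u : Time P k} {f : P.Var} {b : Addr P k} :
    record C u f = some b ↔ P.IsField C f ∧ alloc f u = b := by
  unfold record
  split_ifs with h <;> simp [h]

theorem decodeStore_bot : decodeStore (⊥ : CStore P k r) = ⊥ :=
  funext fun _ => Set.image_empty _

theorem decodeStore_sup (σ τ : CStore P k r) :
    decodeStore (σ ⊔ τ) = decodeStore σ ⊔ decodeStore τ :=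
  funext fun _ => Set.image_union _ _ _

theorem decodeStore_single (a : Addr P k) (d : Set (CVal P k r)) :
    decodeStore (single a d) = single a (decodeVal '' d) := by
  ext b x
  constructor
  · rintro ⟨y, ⟨hb, hy⟩, rfl⟩
    exact ⟨hb, y, hy, rfl⟩
  · rintro ⟨hb, y, hy, rfl⟩
    exact ⟨y, ⟨hb, hy⟩, rfl⟩

theorem decodeStore_bindAll (xs : List P.Var) (t : Time P k) (ds : List (Set (CVal P k r))) :
    decodeStore (bindAll xs t ds) = bindAll xs t (ds.map (decodeVal '' ·)) := by
  ext b x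
  constructor
  · rintro ⟨y, ⟨p, hp, hb, hy⟩, rfl⟩
    refine ⟨(p.1, decodeVal '' p.2), ?_, hb, y, hy, rfl⟩
    rw [List.zip_map_right]
    exact List.mem_map_of_mem (f := Prod.map id (decodeVal '' ·)) hp
  · rintro ⟨p, hp, hb, hx⟩
    rw [List.zip_map_right] at hp
    obtain ⟨p', hp', rfl⟩ := List.mem_map.mp hp
    obtain ⟨y, hy, rfl⟩ := hx
    exact ⟨y, ⟨p', hp', hb, hy⟩, rfl⟩

theorem decodeStore_fieldStore (C : P.Cls) (t : Time P k) (ds : List (Set (CVal P k r))) :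
    decodeStore (fieldStore C t ds) = fieldStore C t (ds.map (decodeVal '' ·)) := by
  ext b x
  constructor
  · rintro ⟨y, ⟨f, i, d, hf, hi, hd, hb, hy⟩, rfl⟩
    exact ⟨f, i, decodeVal '' d, hf, hi, by rw [List.getElem?_map, hd]; rfl, hb, y, hy, rfl⟩
  · rintro ⟨f, i, d, hf, hi, hd, hb, hx⟩
    rw [List.getElem?_map] at hd
    obtain ⟨d', hd', rfl⟩ := Option.map_eq_some_iff.mp hd
    obtain ⟨y, hy, rfl⟩ := hx
    exact ⟨y, ⟨f, i, d', hf, hi, hd', hb, hy⟩, rfl⟩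

theorem decodeStore_thisStore (d : Set (CVal P k r)) (t : Time P k) :
    decodeStore (thisStore r d t) = thisStore r (decodeVal '' d) t := by
  cases r
  · exact decodeStore_bot
  · exact decodeStore_single _ _

theorem decodeFrame_newFrame (M : P.Mth) (p : P.Var × Time P k) (t : Time P k) :
    decodeFrame M (newFrame r p t) = frameEnv M (thisAddr r (alloc p.1 p.2) t) t := by
  cases r <;> rfl

theorem map_decodeStore (σ : CStore P k r) (ps : List (P.Var × Time P k)) :
    (ps.map fun p => alloc p.1 p.2).map (decodeStore σ) =
      (ps.map fun p => σ (alloc p.1 p.2)).map (decodeVal '' ·) := by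
  simp only [List.map_map]
  rfl

theorem decodeConfig_config₀ : decodeConfig (cConfig₀ r) = config₀ (P := P) (k := k) := by
  cases r <;> rfl

theorem decodeState_state₀ : decodeState (cState₀ r) = state₀ (P := P) (k := k) :=
  Prod.ext decodeConfig_config₀ decodeStore_bot

/-! ## No loss of precision -/

/-- Each collapsed rule mirrors one original rule: its lookups decode to lookups, and its store
update is a join of updates that commute with direct images. -/
theorem CStep.decode {c d : CState P k r} (h : CStep r c d) :
    Step r (decodeState c) (decodeState d) := by
  have hlook : ∀ {M : P.Mth} {φ : CFrame P k r} {x p}, look M φ x = some p →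
      decodeFrame M φ x = some (alloc p.1 p.2) :=
    fun h => decodeFrame_eq_some.mpr ⟨_, h, rfl⟩
  cases h with
  | var hs hl hv hv' =>
    simp only [decodeState, decodeConfig, decodeStore_sup, decodeStore_single]
    exact .var hs hl (hlook hv) (hlook hv')
  | ret hs hk hv hv' =>
    simp only [decodeState, decodeConfig, decodeStore_sup, decodeStore_single]
    exact .ret hs (inr_mem_decodeStore.mpr ⟨_, hk, rfl⟩) (hlook hv) (hlook hv')
  | field hs hl hv hv' ho hf =>
    simp only [decodeState, decodeConfig, decodeStore_sup, decodeStore_single]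
    exact .field hs hl (hlook hv) (hlook hv') (inl_mem_decodeStore.mpr ⟨_, ho, rfl⟩)
      (record_eq_some.mpr ⟨hf, rfl⟩)
  | call hs hl hv₀ hargs hM hn =>
    simp only [decodeState, decodeConfig, decodeStore_sup, decodeStore_single,
      decodeStore_bindAll, decodeStore_thisStore, decodeFrame_newFrame, Set.image_singleton,
      ← map_decodeStore]
    exact .call hs hl (hlook hv₀) (forall₂_decodeFrame.mpr ⟨_, hargs, rfl⟩)
      (by rwa [dispatch_decodeStore]) hn
  | newObj hs hl hv hargs hn =>
    simp only [decodeState, decodeConfig, decodeStore_sup, decodeStore_single,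
      decodeStore_fieldStore, Set.image_singleton, ← map_decodeStore]
    exact .newObj hs hl (hlook hv) (forall₂_decodeFrame.mpr ⟨_, hargs, rfl⟩) hn
  | cast hs hl hv hv' =>
    simp only [decodeState, decodeConfig, decodeStore_sup, decodeStore_single]
    exact .cast hs hl (hlook hv) (hlook hv')

/-- Every address that a rule finds in a decoded environment, and every object or continuation that
it finds in a decoded store, has a collapsed preimage. These preimages satisfy the premises of the
mirrored rule. Any choice of them will do, since only the decoding of the result matters. -/
theorem Step.exists_cStep {c : CState P k r} {s : State P k} (h : Step r (decodeState c) s) :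
    ∃ d, CStep r c d ∧ decodeState d = s := by
  obtain ⟨⟨l, φ, q, t⟩, σ⟩ := c
  change Step r ((l, decodeFrame q.1 φ, q, t), decodeStore σ) s at h
  cases h with
  | var hs hl hv hv' =>
    obtain ⟨p, hp, rfl⟩ := decodeFrame_eq_some.mp hv
    obtain ⟨p', hp', rfl⟩ := decodeFrame_eq_some.mp hv'
    refine ⟨_, .var hs hl hp hp', ?_⟩
    simp only [decodeState, decodeConfig, decodeStore_sup, decodeStore_single]
    rfl
  | ret hs hk hv hv' =>
    obtain ⟨φ', hφ', rfl⟩ := inr_mem_decodeStore.mp hk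
    obtain ⟨p, hp, rfl⟩ := decodeFrame_eq_some.mp hv
    obtain ⟨p', hp', rfl⟩ := decodeFrame_eq_some.mp hv'
    refine ⟨_, .ret hs hφ' hp hp', ?_⟩
    simp only [decodeState, decodeConfig, decodeStore_sup, decodeStore_single]
    rfl
  | field hs hl hv hv' ho hf =>
    obtain ⟨p, hp, rfl⟩ := decodeFrame_eq_some.mp hv
    obtain ⟨p', hp', rfl⟩ := decodeFrame_eq_some.mp hv'
    obtain ⟨u, hu, rfl⟩ := inl_mem_decodeStore.mp ho
    obtain ⟨hC, rfl⟩ := record_eq_some.mp hf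
    refine ⟨_, .field hs hl hp hp' hu hC, ?_⟩
    simp only [decodeState, decodeConfig, decodeStore_sup, decodeStore_single]
    rfl
  | call hs hl hv₀ hargs hM hn =>
    obtain ⟨p, hp, rfl⟩ := decodeFrame_eq_some.mp hv₀
    obtain ⟨ps, hps, rfl⟩ := forall₂_decodeFrame.mp hargs
    rw [dispatch_decodeStore] at hM
    refine ⟨_, .call hs hl hp hps hM hn, ?_⟩
    simp only [decodeState, decodeConfig, decodeStore_sup, decodeStore_single,
      decodeStore_bindAll, decodeStore_thisStore, decodeFrame_newFrame, Set.image_singleton,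
      ← map_decodeStore]
    rfl
  | newObj hs hl hv hargs hn =>
    obtain ⟨p, hp, rfl⟩ := decodeFrame_eq_some.mp hv
    obtain ⟨ps, hps, rfl⟩ := forall₂_decodeFrame.mp hargs
    refine ⟨_, .newObj hs hl hp hps hn, ?_⟩
    simp only [decodeState, decodeConfig, decodeStore_sup, decodeStore_single,
      decodeStore_fieldStore, Set.image_singleton, ← map_decodeStore]
    rfl
  | cast hs hl hv hv' =>
    obtain ⟨p, hp, rfl⟩ := decodeFrame_eq_some.mp hv
    obtain ⟨p', hp', rfl⟩ := decodeFrame_eq_some.mp hv'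
    refine ⟨_, .cast hs hl hp hp', ?_⟩
    simp only [decodeState, decodeConfig, decodeStore_sup, decodeStore_single]
    rfl

theorem step_decodeState_iff {c : CState P k r} {s : State P k} :
    Step r (decodeState c) s ↔ ∃ d, CStep r c d ∧ decodeState d = s :=
  ⟨Step.exists_cStep, by rintro ⟨d, h, rfl⟩; exact h.decode⟩

theorem setOf_reachable :
    {s : State P k | Reachable r s} = decodeState '' {c : CState P k r | CReachable r c} := by
  ext s
  constructor
  · intro h
    induction h with
    | refl => exact ⟨_, .refl, decodeState_state₀⟩
    | tail _ h ih =>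
      obtain ⟨c, hc, rfl⟩ := ih
      obtain ⟨d, hd, rfl⟩ := h.exists_cStep
      exact ⟨d, hc.tail hd, rfl⟩
  · rintro ⟨c, hc, rfl⟩
    induction hc with
    | refl => rw [decodeState_state₀]; exact .refl
    | tail _ h ih => exact ih.tail h.decode

theorem transfer_decodeSys (ξ : CSys P k r) :
    transfer r (decodeSys ξ) = decodeSys (cTransfer r ξ) := by
  refine Prod.ext ?_ (funext fun a => ?_)
  · ext c'
    constructor
    · rintro ((rfl | hc') | ⟨_, ⟨c, hc, rfl⟩, σ', h⟩)
      · exact ⟨_, .inl (.inl rfl), decodeConfig_config₀⟩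
      · exact Set.image_mono (fun _ h => .inl (.inr h)) hc'
      -- All configurations share one store, so each of them together with the decoded store is the
      -- decoding of a collapsed state.
      · obtain ⟨⟨d, τ⟩, hd, he⟩ := Step.exists_cStep (c := (c, ξ.2)) h
        exact ⟨d, .inr ⟨c, hc, τ, hd⟩, congrArg Prod.fst he⟩
    · rintro ⟨_, ((rfl | hc') | ⟨c, hc, σ', h⟩), rfl⟩
      · exact .inl (.inl decodeConfig_config₀)
      · exact .inl (.inr ⟨_, hc', rfl⟩)
      · exact .inr ⟨_, ⟨c, hc, rfl⟩, _, h.decode⟩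
  · ext x
    constructor
    · rintro (hx | ⟨_, ⟨c, hc, rfl⟩, c', σ', h, hx⟩)
      · exact Set.image_mono (fun _ h => .inl h) hx
      · obtain ⟨⟨d, τ⟩, hd, he⟩ := Step.exists_cStep (c := (c, ξ.2)) h
        obtain rfl : decodeStore τ = σ' := congrArg Prod.snd he
        exact Set.image_mono (fun _ h => .inr ⟨c, hc, d, τ, hd, h⟩) hx
    · rintro ⟨y, (hy | ⟨c, hc, c', σ', h, hy⟩), rfl⟩
      · exact .inl ⟨y, hy, rfl⟩
      · exact .inr ⟨_, ⟨c, hc, rfl⟩, _, _, h.decode, y, hy, rfl⟩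

theorem decodeSys_bot : decodeSys (⊥ : CSys P k r) = ⊥ :=
  Prod.ext (Set.image_empty _) decodeStore_bot

theorem iterate_transfer_bot (n : ℕ) :
    (transfer (P := P) (k := k) r)^[n] ⊥ = decodeSys ((cTransfer (P := P) (k := k) r)^[n] ⊥) := by
  have h : Function.Semiconj decodeSys (cTransfer (P := P) (k := k) r) (transfer r) :=
    fun ξ => (transfer_decodeSys ξ).symm
  rw [(h.iterate_right n).eq, decodeSys_bot]

/-! ## Environments live at one time -/

theorem oneTime_record (C : P.Cls) (u : Time P k) : OneTime (record C u) := by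
  intro x y a b ha hb
  obtain ⟨-, rfl⟩ := record_eq_some.mp ha
  obtain ⟨-, rfl⟩ := record_eq_some.mp hb
  rfl

theorem look_snd_of_ne_self {M : P.Mth} {φ : CFrame P k r} {x : P.Var} {p : P.Var × Time P k}
    (hx : x ≠ P.self) (h : look M φ x = some p) : p.2 = φ.1 := by
  unfold look at h
  split_ifs at h
  cases h
  rfl

theorem oneTimeButThis_decodeFrame (M : P.Mth) (φ : CFrame P k r) :
    OneTimeButThis (decodeFrame M φ) := by
  intro x y a b hx hy ha hb
  obtain ⟨p, hp, rfl⟩ := decodeFrame_eq_some.mp ha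
  obtain ⟨p', hp', rfl⟩ := decodeFrame_eq_some.mp hb
  exact (look_snd_of_ne_self hx hp).trans (look_snd_of_ne_self hy hp').symm

theorem look_snd_of_copy {M : P.Mth} {φ : CFrame P k .copy} {x : P.Var} {p : P.Var × Time P k}
    (h : look M φ x = some p) : p.2 = φ.1 := by
  unfold look at h
  split_ifs at h <;> cases h <;> rfl

theorem oneTime_decodeFrame (M : P.Mth) (φ : CFrame P k .copy) : OneTime (decodeFrame M φ) := by
  intro x y a b ha hb
  obtain ⟨p, hp, rfl⟩ := decodeFrame_eq_some.mp ha
  obtain ⟨p', hp', rfl⟩ := decodeFrame_eq_some.mp hb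
  exact (look_snd_of_copy hp).trans (look_snd_of_copy hp').symm

theorem exists_of_isRecordIn {β : BEnv P k} {c : CState P k r} (h : IsRecordIn β (decodeState c)) :
    ∃ C u, record C u = β := by
  obtain ⟨a, C, h⟩ := h
  obtain ⟨u, -, h⟩ := inl_mem_decodeStore.mp h
  exact ⟨C, u, h⟩

theorem exists_of_isFrameIn {β : BEnv P k} {c : CState P k r} (h : IsFrameIn β (decodeState c)) :
    ∃ (M : P.Mth) (φ : CFrame P k r), decodeFrame M φ = β := by
  obtain rfl | ⟨a, v, l, q, h⟩ := h
  · exact ⟨_, _, rfl⟩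
  · obtain ⟨φ, -, h⟩ := inr_mem_decodeStore.mp h
    exact ⟨q.1, φ, h⟩

/-- Any field reveals the time through its address. A class without fields has the empty record at
all times, hence the hypothesis. -/
theorem record_injective {C : P.Cls} (h : ∃ f, P.IsField C f) :
    Function.Injective (record (k := k) C) := by
  obtain ⟨f, hf⟩ := h
  intro t u htu
  have h₁ : record C t f = some (alloc f t) := record_eq_some.mpr ⟨hf, rfl⟩
  rw [htu] at h₁
  exact (congrArg Prod.snd (record_eq_some.mp h₁).2).symm

theorem alloc_injective {p p' : P.Var × Time P k} (h : alloc p.1 p.2 = alloc p'.1 p'.2) :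
    p = p' := by
  simp only [alloc, Prod.mk.injEq, Sum.inl.injEq] at h
  exact Prod.ext h.1 h.2

theorem look_injective {M : P.Mth} {φ ψ : CFrame P k r} (h : decodeFrame M φ = decodeFrame M ψ) :
    look M φ = look M ψ := by
  funext x
  have hx := congrFun h x
  rw [decodeFrame_apply, decodeFrame_apply] at hx
  exact Option.map_injective (fun _ _ => alloc_injective) hx

/-- Since `this` is never a declared variable, its lookup returns the binding of `this` unshadowed.
Under `copy` this binding contains the time of the frame; under `share` it does not, and a declared
variable is needed to recover the time. -/
theorem decodeFrame_injective {M : P.Mth}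
    (h : (P.methodDecl M).names ≠ [] ∨ r = ThisRule.copy) :
    Function.Injective (decodeFrame (k := k) (r := r) M) := by
  intro φ ψ e
  have hl := look_injective e
  have hself : thisOf r φ = thisOf r ψ := by
    simpa [look, P.self_not_declared M] using congrFun hl P.self
  cases r with
  | copy => exact Prod.ext (congrArg Prod.snd hself) rfl
  | share =>
    obtain ⟨x, hx⟩ := List.exists_mem_of_ne_nil _ (h.resolve_right (by simp))
    refine Prod.ext ?_ hself
    simpa [look, hx] using congrFun hl x

/-! ## Monotonicity -/

theorem single_mono {V : Type} (a : Addr P k) {d e : Set V} (h : d ⊆ e) :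
    single a d ≤ single a e :=
  fun _ _ hx => ⟨hx.1, h hx.2⟩

theorem bindAll_map_mono {V : Type} (xs : List P.Var) (t : Time P k) (as : List (Addr P k))
    {σ τ : Addr P k → Set V} (h : σ ≤ τ) :
    bindAll xs t (as.map σ) ≤ bindAll xs t (as.map τ) := by
  rintro b y ⟨p, hp, hb, hy⟩
  rw [List.zip_map_right] at hp
  obtain ⟨⟨x, a⟩, hxa, rfl⟩ := List.mem_map.mp hp
  refine ⟨(x, τ a), ?_, hb, h a hy⟩
  rw [List.zip_map_right]
  exact List.mem_map_of_mem (f := Prod.map id τ) hxa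

theorem fieldStore_map_mono {V : Type} (C : P.Cls) (t : Time P k) (as : List (Addr P k))
    {σ τ : Addr P k → Set V} (h : σ ≤ τ) :
    fieldStore C t (as.map σ) ≤ fieldStore C t (as.map τ) := by
  rintro b y ⟨f, i, d, hf, hi, hd, hb, hy⟩
  rw [List.getElem?_map] at hd
  obtain ⟨a, ha, rfl⟩ := Option.map_eq_some_iff.mp hd
  exact ⟨f, i, τ a, hf, hi, by rw [List.getElem?_map, ha]; rfl, hb, h a hy⟩

theorem thisStore_mono {V : Type} (r : ThisRule) {d e : Set V} (t : Time P k) (h : d ⊆ e) :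
    thisStore r d t ≤ thisStore r e t := by
  cases r
  · exact le_rfl
  · exact single_mono _ h

/-- The store occurs in the premises only positively, through membership, and the contributions of a
rule are monotone in it; a larger store enables the same step to the same configuration. -/
theorem Step.mono {c c' : Config P k} {σ σ' τ : Store P k} (h : Step r (c, σ) (c', σ'))
    (hστ : σ ≤ τ) : ∃ τ', Step r (c, τ) (c', τ') ∧ σ' ≤ τ' := by
  cases h with
  | var hs hl hv hv' =>
    exact ⟨_, .var hs hl hv hv', sup_le_sup hστ (single_mono _ (hστ _))⟩
  | ret hs hk hv hv' =>
    exact ⟨_, .ret hs (hστ _ hk) hv hv', sup_le_sup hστ (single_mono _ (hστ _))⟩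
  | field hs hl hv hv' ho hf =>
    exact ⟨_, .field hs hl hv hv' (hστ _ ho) hf, sup_le_sup hστ (single_mono _ (hστ _))⟩
  | call hs hl hv₀ hargs hM hn =>
    obtain ⟨C, β, ho, hM⟩ := hM
    exact ⟨_, .call hs hl hv₀ hargs ⟨C, β, hστ _ ho, hM⟩ hn,
      sup_le_sup (sup_le_sup (sup_le_sup hστ le_rfl) (bindAll_map_mono _ _ _ hστ))
        (thisStore_mono _ _ (hστ _))⟩
  | newObj hs hl hv hargs hn =>
    exact ⟨_, .newObj hs hl hv hargs hn,
      sup_le_sup (sup_le_sup hστ (fieldStore_map_mono _ _ _ hστ)) le_rfl⟩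
  | cast hs hl hv hv' =>
    exact ⟨_, .cast hs hl hv hv', sup_le_sup hστ (single_mono _ (hστ _))⟩

theorem transfer_mono (r : ThisRule) : Monotone (transfer (P := P) (k := k) r) := by
  rintro ξ η ⟨h₁, h₂⟩
  refine ⟨?_, fun a => ?_⟩
  · rintro c' ((hc' | hc') | ⟨c, hc, σ', h⟩)
    · exact .inl (.inl hc')
    · exact .inl (.inr (h₁ hc'))
    · obtain ⟨τ', h, -⟩ := h.mono h₂
      exact .inr ⟨c, h₁ hc, τ', h⟩
  · rintro x (hx | ⟨c, hc, c', σ', h, hx⟩)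
    · exact .inl (h₂ a hx)
    · obtain ⟨τ', h, hle⟩ := h.mono h₂
      exact .inr ⟨c, h₁ hc, c', τ', h, hle a hx⟩

theorem le_cTransfer (ξ : CSys P k r) : ξ ≤ cTransfer r ξ :=
  ⟨fun _ hc => .inl (.inr hc), fun _ _ hx => .inl hx⟩

/-! ## Heights -/

instance finite_time : Finite (Time P k) :=
  (List.finite_length_le P.Lab k).to_subtype

instance finite_thisRef : Finite (ThisRef P k r) := by
  cases r
  · exact inferInstanceAs (Finite (P.Var × Time P k))
  · exact inferInstanceAs (Finite Unit)

theorem card_thisRef : Nat.card (ThisRef P k r) = thisFactor P k r := by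
  cases r
  · exact Nat.card_prod _ _
  · exact Nat.card_unique (α := Unit)

/-- The height is the number of configurations plus the number of addresses times the number of
values. Among the three factors `|Time|` of a configuration, one is the frame, one the continuation
pointer and one the current time. -/
theorem krullDim_cSys : Order.krullDim (CSys P k r) = (heightBound P k r : ℕ) := by
  refine (Order.krullDim_set_prod_pi_set (CConfig P k r) (Addr P k) (CVal P k r)).trans ?_
  refine congrArg (fun n : ℕ => (n : WithBot ℕ∞)) ?_
  simp only [Nat.card_prod, Nat.card_sum, card_thisRef, heightBound]
  ring

/-- The largest collapsed system whose decoding is below `ξ`. -/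
def encodeSys (r : ThisRule) (ξ : Sys P k) : CSys P k r :=
  (decodeConfig ⁻¹' ξ.1, fun a => decodeVal ⁻¹' ξ.2 a)

/-- Image and preimage form a Galois connection, and taking the image after the preimage fixes every
image. This makes encoding injective on decoded systems even where decoding itself is not injective.
-/
theorem decodeSys_encodeSys_decodeSys (ξ : CSys P k r) :
    decodeSys (encodeSys r (decodeSys ξ)) = decodeSys ξ :=
  have h : ∀ {α β : Type} (f : α → β) (s : Set α), f '' (f ⁻¹' (f '' s)) = f '' s :=
    fun f s => (Set.image_preimage_subset f _).antisymm
      (Set.image_mono (Set.subset_preimage_image f s))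
  Prod.ext (h _ _) (funext fun _ => h _ _)

/-- Encoding embeds the decoded systems strictly monotonically into the collapsed ones. Only an
inequality results, as collapsed values with equal decodings are identified. -/
theorem krullDim_range_decodeSys :
    Order.krullDim (Set.range (decodeSys (P := P) (k := k) (r := r))) ≤
      (heightBound P k r : ℕ) := by
  rw [← krullDim_cSys]
  refine Order.krullDim_le_of_strictMono (fun ξ => encodeSys r ξ.1)
    (Monotone.strictMono_of_injective ?_ ?_)
  · rintro ξ η ⟨h₁, h₂⟩
    exact ⟨Set.preimage_mono h₁, fun a => Set.preimage_mono (h₂ a)⟩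
  · rintro ⟨_, ξ, rfl⟩ ⟨_, η, rfl⟩ h
    have := congrArg decodeSys h
    simp only [decodeSys_encodeSys_decodeSys] at this
    exact Subtype.ext this

theorem exists_isLeast_iterate_transfer :
    ∃ N ≤ heightBound P k r, IsLeast (Function.fixedPoints (transfer (P := P) (k := k) r))
      ((transfer (P := P) (k := k) r)^[N] ⊥) := by
  obtain ⟨N, hN, h⟩ := Order.exists_iterate_isFixedPt (f := cTransfer (P := P) (k := k) r)
    le_cTransfer ⊥ krullDim_cSys.le
  refine ⟨N, hN, Order.isLeast_fixedPoints_iterate_bot (transfer_mono r) ?_⟩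
  -- The decoding of a fixed point of the collapsed transfer function is fixed, because decoding
  -- intertwines the two functions.
  rw [iterate_transfer_bot, Function.IsFixedPt, transfer_decodeSys, h.eq]

/-! ## Polynomial bounds -/

/-- A sequence of at most `k` labels is determined by its first `k` entries, padded with `none`,
that is, by a word of length `k` over the labels and one extra symbol. -/
theorem card_time_le (P : Program) (k : ℕ) :
    Nat.card (Time P k) ≤ (Nat.card P.Lab + 1) ^ k := by
  have h : Function.Injective
      fun (w : Time P k) (i : Fin k) => w.1[(i : ℕ)]? := by
    intro w w' e
    refine Subtype.ext (List.ext_getElem? fun i => ?_)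
    by_cases hi : i < k
    · exact congrFun e ⟨i, hi⟩
    · rw [List.getElem?_eq_none (by have := w.2; omega),
        List.getElem?_eq_none (by have := w'.2; omega)]
  have := Nat.card_le_card_of_injective _ h
  rwa [Nat.card_fun, Finite.card_option, Nat.card_fin] at this

namespace Program

variable (P : Program)

theorem card_cls_le_size : Nat.card P.Cls ≤ P.size := by
  have : Nat.card P.Cls ≤ ∑ C, (1 + (P.classDecl C).names.length) := by
    rw [Finset.sum_add_distrib]; simp
  unfold size; omega

theorem card_mth_le_size : Nat.card P.Mth ≤ P.size := by
  have : Nat.card P.Mth ≤ ∑ M, (1 + (P.methodDecl M).names.length) := by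
    rw [Finset.sum_add_distrib]; simp
  unfold size; omega

theorem card_lab_le_size : Nat.card P.Lab ≤ P.size := by
  have : Nat.card P.Lab ≤ ∑ l, (1 + (P.stmt l).names.length) := by
    rw [Finset.sum_add_distrib]; simp
  unfold size; omega

/-- Every name occurs in the program text, except possibly `this`, which accounts for the extra one.
-/
theorem card_var_le_size_add_one : Nat.card P.Var ≤ P.size + 1 := by
  classical
  have hsub : (Finset.univ : Finset P.Var) ⊆
      {P.self} ∪ (Finset.univ.biUnion fun C => (P.classDecl C).names.toFinset) ∪
        (Finset.univ.biUnion fun M => (P.methodDecl M).names.toFinset) ∪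
        Finset.univ.biUnion fun l => (P.stmt l).names.toFinset := by
    intro x _
    simpa [or_assoc] using P.var_occurs x
  have hle : ∀ {ι : Type} [Fintype ι] (g : ι → List P.Var),
      (Finset.univ.biUnion fun i => (g i).toFinset).card ≤ ∑ i, (1 + (g i).length) :=
    fun g => Finset.card_biUnion_le.trans
      (Finset.sum_le_sum fun i _ => (g i).toFinset_card_le.trans (Nat.le_add_left _ _))
  have h := Finset.card_le_card hsub
  rw [Finset.card_univ, ← Nat.card_eq_fintype_card] at h
  have h₁ := hle fun C => (P.classDecl C).names
  have h₂ := hle fun M => (P.methodDecl M).names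
  have h₃ := hle fun l => (P.stmt l).names
  refine h.trans ((Finset.card_union_le _ _).trans ?_)
  refine (Nat.add_le_add_right (Finset.card_union_le _ _) _).trans ?_
  refine (Nat.add_le_add_right (Nat.add_le_add_right (Finset.card_union_le _ _) _) _).trans ?_
  rw [Finset.card_singleton]
  unfold size
  omega

end Program

open Polynomial in
theorem exists_polynomial_heightBound_le (k : ℕ) :
    ∃ p : ℕ[X], ∀ (P : Program) (r : ThisRule), heightBound P k r ≤ p.eval P.size := by
  -- At the size of the program, `n` bounds the numbers of names, classes, methods and labels, `T`
  -- the number of times, and `w` the factor for `this` in both analyses. The witness is the height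
  -- formula with these substituted.
  let n : ℕ[X] := X + 1
  let T : ℕ[X] := n ^ k
  let w : ℕ[X] := n * T
  refine ⟨w * (n * T ^ 3 * n) + (n + n) * T * (n * T + w * (n * n * T * n * T)), fun P r => ?_⟩
  have hC := P.card_cls_le_size.trans (Nat.le_succ _)
  have hM := P.card_mth_le_size.trans (Nat.le_succ _)
  have hL := P.card_lab_le_size.trans (Nat.le_succ _)
  have hV := P.card_var_le_size_add_one
  have hT : Nat.card (Time P k) ≤ (P.size + 1) ^ k :=
    (card_time_le P k).trans (Nat.pow_le_pow_left (Nat.succ_le_succ P.card_lab_le_size) k)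
  have hw : thisFactor P k r ≤ (P.size + 1) * (P.size + 1) ^ k := by
    cases r
    · exact Nat.mul_le_mul hV hT
    · exact Nat.succ_le_of_lt (by positivity)
  simp only [heightBound, Nat.card_sum, eval_add, eval_mul, eval_pow, eval_X, eval_one, n, T, w]
  simp only [Nat.succ_eq_add_one] at hC hM hL
  gcongr

end FJ

theorem mainTheorem2 (k : ℕ) :
    (∀ (P : FJ.Program) (r : FJ.ThisRule),
      -- in every reachable state, each environment lives at one time
      (∀ s : FJ.State P k, FJ.Reachable r s →
        (∀ β, FJ.IsRecordIn β s → FJ.OneTime β) ∧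
        (∀ β, FJ.IsFrameIn β s → FJ.OneTimeButThis β) ∧
        (r = FJ.ThisRule.copy → ∀ β, FJ.IsFrameIn β s → FJ.OneTime β)) ∧
      -- times determine environments, and are determined by them
      (∀ C : P.Cls, (∃ f, P.IsField C f) →
        Function.Injective (FJ.record (k := k) C)) ∧
      (∀ M : P.Mth, ((P.methodDecl M).names ≠ [] ∨ r = FJ.ThisRule.copy) →
        Function.Injective (FJ.decodeFrame (k := k) (r := r) M)) ∧
      -- no loss of precision, transition by transition and for the reachable states
      FJ.decodeState (FJ.cState₀ (P := P) (k := k) r) = FJ.state₀ ∧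
      (∀ (c : FJ.CState P k r) (s : FJ.State P k),
        FJ.Step r (FJ.decodeState c) s ↔ ∃ d, FJ.CStep r c d ∧ FJ.decodeState d = s) ∧
      {s : FJ.State P k | FJ.Reachable r s} =
        FJ.decodeState '' {c : FJ.CState P k r | FJ.CReachable r c} ∧
      -- no loss of precision for the analysis with a single-threaded store
      (∀ ξ : FJ.CSys P k r,
        FJ.transfer r (FJ.decodeSys ξ) = FJ.decodeSys (FJ.cTransfer r ξ)) ∧
      (∀ n : ℕ, (FJ.transfer (P := P) (k := k) r)^[n] ⊥ =
        FJ.decodeSys ((FJ.cTransfer (P := P) (k := k) r)^[n] ⊥)) ∧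
      -- the heights of the collapsed system space and of the part of the original one that it
      -- stands for
      Order.krullDim (FJ.CSys P k r) = (FJ.heightBound P k r : ℕ) ∧
      Order.krullDim (Set.range (FJ.decodeSys (P := P) (k := k) (r := r))) ≤
        (FJ.heightBound P k r : ℕ) ∧
      -- the analysis is complete after at most that many rounds
      (∃ N ≤ FJ.heightBound P k r,
        IsLeast (Function.fixedPoints (FJ.transfer (P := P) (k := k) r))
          ((FJ.transfer (P := P) (k := k) r)^[N] ⊥))) ∧
    -- for fixed `k` the height is polynomial in the size of the program
    ∃ p : Polynomial ℕ, ∀ (P : FJ.Program) (r : FJ.ThisRule),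
      FJ.heightBound P k r ≤ p.eval P.size := by
  refine ⟨fun P r => ⟨fun s hs => ?_, fun C => FJ.record_injective,
    fun M => FJ.decodeFrame_injective, FJ.decodeState_state₀, fun c s => FJ.step_decodeState_iff,
    FJ.setOf_reachable, FJ.transfer_decodeSys, FJ.iterate_transfer_bot, FJ.krullDim_cSys,
    FJ.krullDim_range_decodeSys, FJ.exists_isLeast_iterate_transfer⟩,
    FJ.exists_polynomial_heightBound_le k⟩
  -- For the claim on times it only matters that the state is a decoding; every decoded record and
  -- frame has the required form, whether reachable or not.
  have hs' : s ∈ FJ.decodeState '' {c : FJ.CState P k r | FJ.CReachable r c} :=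
    FJ.setOf_reachable.subset hs
  obtain ⟨c, -, rfl⟩ := hs'
  refine ⟨fun β h => ?_, fun β h => ?_, fun hr β h => ?_⟩
  · obtain ⟨C, u, rfl⟩ := FJ.exists_of_isRecordIn h
    exact FJ.oneTime_record C u
  · obtain ⟨M, φ, rfl⟩ := FJ.exists_of_isFrameIn h
    exact FJ.oneTimeButThis_decodeFrame M φ
  · subst hr
    obtain ⟨M, φ, rfl⟩ := FJ.exists_of_isFrameIn h
    exact FJ.oneTime_decodeFrame M φ
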